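/- Let $k$ be an infinite field, let $n,m\ge 0$ be integers with $n\le m/2$, let $\tau_1,\tau_2$ be endomorphisms of $k^m$, and let $\rho$ be a linear projection onto $\operatorname{im}(\tau_2)$, i.e. an idempotent endomorphism of $k^m$ with $\operatorname{im}(\rho)=\operatorname{im}(\tau_2)$. Let $R,T_1,T_2\in k^{m\times m}$ be the matrices of $\rho,\tau_1,\tau_2$ on the canonical basis, let $k[x]=k[x_1,\dots,x_m]$ and $x=(x_1,\dots,x_m)^{\top}$, and let $I_{\rho\tau_1,\tau_2}\subseteq k[x]$ be the ideal generated by all $2$-minors of the $m\times 2$ matrix $[\,RT_1x\ \ T_2x\,]$. Put $Y_{\rho\tau_1,\tau_2}=\operatorname{Spec}(k[x]/I_{\rho\tau_1,\tau_2})\subseteq\operatorname{Spec}k[x]$; for a $k$-subspace $V\subseteq k^m$ with vanishing ideal $I_V\subseteq k[x]$ put $\overline V=\operatorname{Spec}(k[x]/I_V)\subseteq\operatorname{Spec}k[x]$; and let $$U_{\rho\tau_1,\tau_2}=Y_{\rho\tau_1,\tau_2}\setminus\big(\overline{\ker(\rho\tau_1-\tau_2)}\cup\overline{\ker(\rho\tau_1)}\cup\overline{\ker(\tau_2)}\big).$$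 Suppose that $\dim U_{\rho\tau_1,\tau_2}\le m-n$ (Krull dimension), $\dim_k\operatorname{im}(\tau_2)\ge 2n$ and $\dim_k\operatorname{im}(\tau_1)\ge n$. Then there is a dense open set $\mathscr U\subseteq\operatorname{Gr}(n,m)$, for the Zariski topology on the Grassmannian of $n$-dimensional $k$-subspaces of $k^m$, such that for every $V\in\mathscr U$ and all $v_1,v_2\in V$, $\tau_1(v_1)=\tau_2(v_2)$ implies $v_1=v_2$. -/

import Mathlib

noncomputable section

namespace HomSensing

variable {k : Type*} [Field k] {m : ℕ}

/-- The `m × 2` matrix `[A x, B x]` of linear forms in `k[x₁, …, xₘ]`, where `A`, `B` are the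
matrices of `α`, `β` on the canonical basis of `k^m` and `x = (x₁, …, xₘ)` is the column of
variables. -/
def pairMatrix (α β : Module.End k (Fin m → k)) :
    Matrix (Fin m) (Fin 2) (MvPolynomial (Fin m) k) :=
  Matrix.of fun i =>
    ![(LinearMap.toMatrix' α).toMvPolynomial i, (LinearMap.toMatrix' β).toMvPolynomial i]

/-- The ideal `I_{α,β}` generated by all 2-minors of `[A x, B x]`. -/
def minorIdeal (α β : Module.End k (Fin m → k)) : Ideal (MvPolynomial (Fin m) k) :=
  Ideal.span {d | ∃ i j : Fin m, i < j ∧ d = ((pairMatrix α β).submatrix ![i, j] id).det}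

/-- The closed subset `V̄ = Spec (k[x] / I_V)` of affine space `Spec k[x]`, where `I_V` is the
vanishing ideal of the subspace `V ⊆ k^m`. -/
def closedSubspace (V : Submodule k (Fin m → k)) :
    Set (PrimeSpectrum (MvPolynomial (Fin m) k)) :=
  PrimeSpectrum.zeroLocus
    (MvPolynomial.vanishingIdeal k (V : Set (Fin m → k)) : Set (MvPolynomial (Fin m) k))

/-- The closed subset `Y_{α,β} = Spec (k[x] / I_{α,β})` of affine space `Spec k[x]`. -/
def Y (α β : Module.End k (Fin m → k)) : Set (PrimeSpectrum (MvPolynomial (Fin m) k)) :=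
  PrimeSpectrum.zeroLocus (minorIdeal α β : Set (MvPolynomial (Fin m) k))

/-- The locally closed determinantal locus `U_{α,β}`: the locus `Y_{α,β}` with the closed subsets
of `ker (α - β)`, `ker α` and `ker β` removed. -/
def U (α β : Module.End k (Fin m → k)) : Set (PrimeSpectrum (MvPolynomial (Fin m) k)) :=
  Y α β \ (closedSubspace (LinearMap.ker (α - β)) ∪ closedSubspace (LinearMap.ker α) ∪
    closedSubspace (LinearMap.ker β))

/-- `Gr k n m`: the Grassmannian of `n`-dimensional `k`-subspaces of `k^m`. -/
def Gr (k : Type*) [Field k] (n m : ℕ) : Type _ :=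
  {V : Submodule k (Fin m → k) // Module.finrank k V = n}

/-- Bases of `n`-dimensional subspaces of `k^m`: the `m × n` matrices, as points of affine
`mn`-space, with linearly independent columns. -/
def Frame (k : Type*) [Field k] (n m : ℕ) : Type _ :=
  {A : Fin m × Fin n → k // LinearIndependent k fun (j : Fin n) (i : Fin m) => A (i, j)}

/-- The Zariski topology on frames, a subspace of affine `mn`-space: the closed sets are the common
zero sets of families of polynomials in the `mn` matrix entries. -/
instance Frame.zariski (k : Type*) [Field k] (n m : ℕ) : TopologicalSpace (Frame k n m) :=
  TopologicalSpace.induced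
    (fun A => (MvPolynomial.pointToPoint A.1 : PrimeSpectrum (MvPolynomial (Fin m × Fin n) k)))
    inferInstance

/-- The map sending a frame to the subspace spanned by its columns. -/
def Frame.toGr {k : Type*} [Field k] {n m : ℕ} (A : Frame k n m) : Gr k n m :=
  ⟨Submodule.span k (Set.range fun (j : Fin n) (i : Fin m) => A.1 (i, j)), by
    simpa using finrank_span_eq_card A.2⟩

/-- The Zariski topology on the (`k`-points of the) Grassmannian, as the quotient of the variety of
frames by the change of basis action of `GLₙ`: a set of subspaces is open when the set of its bases
is open. The quotient map has polynomial local sections over the standard affine charts, so this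
agrees with the topology given by the charts or by the Plücker embedding. -/
instance Gr.zariski (k : Type*) [Field k] (n m : ℕ) : TopologicalSpace (Gr k n m) :=
  TopologicalSpace.coinduced Frame.toGr inferInstance

end HomSensing

end

/-!
A property of `n`-dimensional subspaces of `k^m` is tested on the `m × n` matrices `A` with the
given column space, and it suffices to find a nonzero polynomial in the entries of `A` off whose
zero set the property holds (`HoldsGenerically.exists_isOpen_dense`): the column spaces of the
matrices where the polynomial does not vanish form an open set, which is dense because `k` is
infinite.

Such polynomials come from dimension counts. If the bad matrices are parametrized polynomially by
the `k`-points of an affine variety of dimension less than `m n`, then the `m n` entries are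
algebraically dependent functions on that variety, and a relation among them vanishes at all bad
matrices (`HoldsGenerically.not_mem_image`). The bound of the number of algebraically independent
functions by the Krull dimension is Noether normalization
(`AlgebraicIndependent.card_le_ringKrullDim`). The argument uses only the `k`-points of the
variety, so that `k` need not be algebraically closed.

The counts show that a generic `V` has three properties, `α` being `ρ τ₁` and `β` being `τ₂`. It
meets the kernels of `τ₁` and `τ₂` trivially (`holdsGenerically_ker_eq_bot`). It contains no
`k`-point of `U α β`, because this cone has dimension at most `m - n`
(`holdsGenerically_avoids_U`). It contains no independent pair `(v₁, v₂)` with `α v₁ = β v₂`,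
because such pairs form a linear space of dimension `2 m - rank τ₂ ≤ 2 (m - n)`
(`holdsGenerically_not_mem_of_independent`).

Let `τ₁ v₁ = τ₂ v₂` with `v₁, v₂ ∈ V`. Applying `ρ`, which fixes the image of `τ₂`, gives
`α v₁ = β v₂`, so `v₁` and `v₂` are dependent. If `v₁ = 0` then `v₂ = 0`. Otherwise `v₂ = r v₁`, so
that `α v₁ = r β v₁`; since `v₁` is not in `U α β`, it lies in the kernel of `α - β`, of `α` or of
`β`. In the first case `r = 1` or `β v₁ = 0`. If `β v₁ = 0`, then `v₁ = 0`. If `α v₁ = 0`, then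
`τ₂ v₂ = 0`, whence `v₂ = 0`, `τ₁ v₁ = 0` and `v₁ = 0`.
-/

/-! ### Krull dimension and algebraic independence -/

theorem ringKrullDim_le_of_isIntegral (R S : Type*) [CommRing R] [CommRing S] [Algebra R S]
    [Algebra.IsIntegral R S] [FaithfulSMul R S] : ringKrullDim R ≤ ringKrullDim S := by
  refine iSup_le fun l => ?_
  obtain ⟨⟨P, hP, hlo⟩⟩ :=
    Ideal.nonempty_primesOver (R := R) (S := S) (RelSeries.head l).asIdeal
  obtain ⟨L, hL, -⟩ := Ideal.exists_ltSeries_of_hasGoingUp (S := S) l P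
  rw [← hL]
  exact le_iSup (fun p : LTSeries (PrimeSpectrum S) => ((p.length : ℕ∞) : WithBot ℕ∞)) L

/-- The dimension of a finitely generated domain over a field bounds its transcendence degree:
by Noether normalization the domain is integral over a polynomial ring, with the same
transcendence degree and no larger dimension. -/
theorem AlgebraicIndependent.card_le_ringKrullDim_of_isDomain {k C ι : Type*} [Field k]
    [CommRing C] [IsDomain C] [Algebra k C] [Algebra.FiniteType k C] [Fintype ι] {x : ι → C}
    (hx : AlgebraicIndependent k x) : (Fintype.card ι : WithBot ℕ∞) ≤ ringKrullDim C := by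
  obtain ⟨s, g, hg, hgi⟩ := exists_integral_inj_algHom_of_fg k C
  algebraize [g.toRingHom]
  have : IsScalarTower k (MvPolynomial (Fin s) k) C := .of_algHom g
  have : FaithfulSMul (MvPolynomial (Fin s) k) C :=
    (faithfulSMul_iff_algebraMap_injective _ _).2 hg
  have : Algebra.IsIntegral (MvPolynomial (Fin s) k) C := ⟨hgi⟩
  have hdim := ringKrullDim_le_of_isIntegral (MvPolynomial (Fin s) k) C
  rw [MvPolynomial.ringKrullDim_of_isNoetherianRing, ringKrullDim_eq_zero_of_field, zero_add,
    Nat.card_fin] at hdim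
  refine le_trans ?_ hdim
  have h1 := lift_trdeg_add_eq k (MvPolynomial (Fin s) k) C
  rw [trdeg_eq_zero (R := MvPolynomial (Fin s) k) (A := C)] at h1
  have h2 := hx.lift_cardinalMk_le_trdeg
  have h3 : Algebra.trdeg k C = s := by simpa using h1.symm
  rw [h3] at h2
  have : Fintype.card ι ≤ s := by simpa using h2
  exact_mod_cast this

/-- The dimension of a finitely generated algebra over a field bounds the number of algebraically
independent elements: a prime of the algebra lying over the zero ideal of the polynomial ring
reduces this to the quotient domain. -/
theorem AlgebraicIndependent.card_le_ringKrullDim {k B ι : Type*} [Field k]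
    [CommRing B] [Algebra k B] [Algebra.FiniteType k B] [Fintype ι] {x : ι → B}
    (hx : AlgebraicIndependent k x) : (Fintype.card ι : WithBot ℕ∞) ≤ ringKrullDim B := by
  have hinj : Function.Injective (MvPolynomial.aeval (R := k) x).toRingHom := hx
  obtain ⟨q, hq, hqc⟩ := Ideal.exists_comap_eq_of_mem_minimalPrimes_of_injective hinj ⊥
    (by rw [IsDomain.minimalPrimes_eq_singleton_bot]; rfl)
  have hx' : AlgebraicIndependent k (fun i => Ideal.Quotient.mkₐ k q (x i)) := by
    rw [algebraicIndependent_iff]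
    intro p hp
    have hp' : Ideal.Quotient.mkₐ k q (MvPolynomial.aeval x p) = 0 := by
      rw [← hp, MvPolynomial.comp_aeval_apply]
    have hmem : p ∈ Ideal.comap (MvPolynomial.aeval (R := k) x).toRingHom q :=
      Ideal.mem_comap.2 (Ideal.Quotient.eq_zero_iff_mem.1 hp')
    rwa [hqc, Ideal.mem_bot] at hmem
  exact hx'.card_le_ringKrullDim_of_isDomain.trans (ringKrullDim_quotient_le q)

theorem exists_ne_zero_aeval_eq_zero {k B ι σ : Type*} [Field k] [CommRing B] [Algebra k B]
    [Algebra.FiniteType k B] [Fintype ι] [Fintype σ] {d : ℕ}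
    (hd : ringKrullDim B ≤ (d : WithBot ℕ∞)) (hlt : d + Fintype.card σ < Fintype.card ι)
    (g : ι → MvPolynomial σ B) :
    ∃ P : MvPolynomial ι k, P ≠ 0 ∧ MvPolynomial.aeval g P = 0 := by
  by_contra! h
  have hg : AlgebraicIndependent k g := by
    rw [algebraicIndependent_iff]
    intro p hp
    by_contra h0
    exact h p h0 hp
  have : IsNoetherianRing B := Algebra.FiniteType.isNoetherianRing k B
  have h1 := hg.card_le_ringKrullDim
  rw [MvPolynomial.ringKrullDim_of_isNoetherianRing, Nat.card_eq_fintype_card] at h1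
  have h2 : (Fintype.card ι : WithBot ℕ∞) ≤ (d : WithBot ℕ∞) + (Fintype.card σ : WithBot ℕ∞) :=
    h1.trans (by gcongr)
  have : Fintype.card ι ≤ d + Fintype.card σ := by exact_mod_cast h2
  omega

namespace HomSensing

/-! ### Generic properties of matrices -/

/-- `HoldsGenerically Q`: the property `Q` of points of affine space holds off the zero set of some
nonzero polynomial. -/
def HoldsGenerically {k ι : Type*} [Field k] (Q : (ι → k) → Prop) : Prop :=
  ∃ P : MvPolynomial ι k, P ≠ 0 ∧ ∀ A, MvPolynomial.eval A P ≠ 0 → Q A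

namespace HoldsGenerically

variable {k ι : Type*} [Field k] {Q Q' : (ι → k) → Prop}

theorem mono (h : HoldsGenerically Q) (hQ : ∀ A, Q A → Q' A) : HoldsGenerically Q' :=
  let ⟨P, hP, hPQ⟩ := h
  ⟨P, hP, fun A hA => hQ A (hPQ A hA)⟩

theorem and (h : HoldsGenerically Q) (h' : HoldsGenerically Q') :
    HoldsGenerically fun A => Q A ∧ Q' A := by
  obtain ⟨P, hP, hPQ⟩ := h
  obtain ⟨P', hP', hPQ'⟩ := h'
  refine ⟨P * P', mul_ne_zero hP hP', fun A hA => ?_⟩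
  rw [map_mul] at hA
  exact ⟨hPQ A (left_ne_zero_of_mul hA), hPQ' A (right_ne_zero_of_mul hA)⟩

theorem forall_finite {κ : Type*} [Finite κ] {Q : κ → (ι → k) → Prop}
    (h : ∀ t, HoldsGenerically (Q t)) : HoldsGenerically fun A => ∀ t, Q t A := by
  have := Fintype.ofFinite κ
  choose P hP hPQ using h
  refine ⟨∏ t, P t, Finset.prod_ne_zero_iff.2 fun t _ => hP t, fun A hA t => hPQ t A ?_⟩
  rw [map_prod] at hA
  exact Finset.prod_ne_zero_iff.1 hA t (Finset.mem_univ t)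

/-- A generic point of `ι`-dimensional affine space avoids the image of a family of points
parametrized polynomially by fewer than `ι` parameters: here the parameters are a point `β` of an
affine variety of dimension at most `d` with coordinate ring `B`, and a point `s` of `σ`-dimensional
affine space. -/
theorem not_mem_image {B σ : Type*} [CommRing B] [Algebra k B]
    [Algebra.FiniteType k B] [Fintype ι] [Fintype σ] {d : ℕ}
    (hd : ringKrullDim B ≤ (d : WithBot ℕ∞)) (hlt : d + Fintype.card σ < Fintype.card ι)
    (g : ι → MvPolynomial σ B) :
    HoldsGenerically fun A : ι → k => ∀ (β : B →ₐ[k] k) (s : σ → k),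
      ∃ t, MvPolynomial.aevalTower β s (g t) ≠ A t := by
  obtain ⟨P, hP, hPg⟩ := exists_ne_zero_aeval_eq_zero (k := k) hd hlt g
  refine ⟨P, hP, fun A hA β s => ?_⟩
  by_contra! h
  apply hA
  have h1 := MvPolynomial.comp_aeval_apply g (MvPolynomial.aevalTower β s) P
  rw [hPg, map_zero, funext h] at h1
  simpa [MvPolynomial.aeval_eq_eval] using h1.symm

end HoldsGenerically

variable {k : Type*} [Field k] {m n : ℕ}

theorem exists_sum_smul_eq_of_mem {ι M : Type*} [Fintype ι] [AddCommGroup M] [Module k M]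
    {K : Submodule k M} (b : Module.Basis ι k K) {w : M} (hw : w ∈ K) :
    ∃ z : ι → k, ∑ t, z t • (b t : M) = w :=
  ⟨b.repr ⟨w, hw⟩, by
    have := congrArg Subtype.val (b.sum_repr ⟨w, hw⟩)
    simpa only [AddSubmonoidClass.coe_finsetSum, Submodule.coe_smul] using this⟩

/-- The `m × n` matrix with given entries. -/
abbrev matrixOf (A : Fin m × Fin n → k) : Matrix (Fin m) (Fin n) k := Matrix.of fun i j => A (i, j)

/-- If `x` ranges over a variety of dimension at most `m - n` in affine `m`-space, given by its
coordinate ring `B` and the coordinate functions `ξ`, then a generic matrix `A` satisfies no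
equation `A c = x` with `c j₀ = 1`: column `j₀` of `A` is determined by `x`, by the other columns
and by the remaining coefficients, which makes at most `m n - 1` parameters. For a cone the
condition `c j₀ = 1` means `c ≠ 0`, by scaling. -/
theorem holdsGenerically_mulVec_ne {B : Type*} [CommRing B] [Algebra k B]
    [Algebra.FiniteType k B] (hnm : n ≤ m) (hd : ringKrullDim B ≤ ((m - n : ℕ) : WithBot ℕ∞))
    (ξ : Fin m → B) :
    HoldsGenerically fun A : Fin m × Fin n → k => ∀ (j₀ : Fin n) (c : Fin n → k), c j₀ = 1 →
      ∀ β : B →ₐ[k] k, (matrixOf A).mulVec c ≠ fun i => β (ξ i) := by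
  refine HoldsGenerically.forall_finite fun j₀ => ?_
  have hcard : m - n + Fintype.card (({j // j ≠ j₀} × Fin m) ⊕ {j // j ≠ j₀})
      < Fintype.card (Fin m × Fin n) := by
    have hn : 0 < n := j₀.pos
    simp only [Fintype.card_sum, Fintype.card_prod, Fintype.card_fin, ne_eq,
      Fintype.card_subtype_compl, Fintype.card_unique]
    obtain ⟨n, rfl⟩ := Nat.exists_eq_succ_of_ne_zero hn.ne'
    simp only [Nat.succ_eq_add_one, Nat.add_sub_cancel]
    have : m * (n + 1) = n * m + m := by ring
    omega
  refine (HoldsGenerically.not_mem_image hd hcard fun t =>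
    if h : t.2 = j₀ then
      .C (ξ t.1) - ∑ l, .X (.inr l) * .X (.inl (l, t.1))
    else .X (.inl (⟨t.2, h⟩, t.1))).mono fun A hA c hc β h => ?_
  obtain ⟨⟨i, j⟩, ht⟩ := hA β (Sum.elim (fun t => A (t.2, t.1)) fun l => c l)
  apply ht
  by_cases hj : j = j₀
  · subst hj
    have hi := congrFun h i
    simp only [Matrix.mulVec, dotProduct, Matrix.of_apply] at hi
    rw [Fintype.sum_eq_add_sum_subtype_ne _ j, hc] at hi
    simp [← hi, mul_comm]
  · simp [hj]

/-! ### Kernels -/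

/-- A generic `n`-dimensional subspace meets the kernel of `τ` trivially, if `τ` has rank at least
`n`. -/
theorem holdsGenerically_ker_eq_bot (hnm : n ≤ m) (τ : Module.End k (Fin m → k))
    (hτ : n ≤ Module.finrank k (LinearMap.range τ)) :
    HoldsGenerically fun A : Fin m × Fin n → k =>
      ∀ c, τ ((matrixOf A).mulVec c) = 0 → c = 0 := by
  let b := Module.finBasis k (LinearMap.ker τ)
  have hd : ringKrullDim (MvPolynomial (Fin (Module.finrank k (LinearMap.ker τ))) k)
      ≤ ((m - n : ℕ) : WithBot ℕ∞) := by
    have := τ.finrank_range_add_finrank_ker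
    rw [Module.finrank_fin_fun] at this
    rw [MvPolynomial.ringKrullDim_of_isNoetherianRing, ringKrullDim_eq_zero_of_field, zero_add,
      Nat.card_fin]
    exact_mod_cast (by omega : Module.finrank k (LinearMap.ker τ) ≤ m - n)
  refine (holdsGenerically_mulVec_ne hnm hd
    fun i => ∑ t, .C ((b t).1 i) * .X t).mono fun A hA c hc => ?_
  by_contra hc0
  obtain ⟨j, hj⟩ := Function.ne_iff.1 hc0
  have hw : (matrixOf A).mulVec ((c j)⁻¹ • c) ∈ LinearMap.ker τ := by
    rw [LinearMap.mem_ker, Matrix.mulVec_smul, map_smul, hc, smul_zero]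
  obtain ⟨z, hz⟩ := exists_sum_smul_eq_of_mem b hw
  refine hA j ((c j)⁻¹ • c) (inv_mul_cancel₀ hj) (MvPolynomial.aeval z) ?_
  rw [← hz]
  ext i
  simp [Finset.sum_apply, mul_comm]

/-! ### The determinantal locus -/

theorem eval_toMvPolynomial (α : Module.End k (Fin m → k)) (i : Fin m) (x : Fin m → k) :
    MvPolynomial.eval x ((LinearMap.toMatrix' α).toMvPolynomial i) = α x i := by
  rw [Matrix.toMvPolynomial_eval_eq_apply, LinearMap.toMatrix'_mulVec]

theorem eval_eq_zero_of_mem_minorIdeal {α β : Module.End k (Fin m → k)} {x : Fin m → k} {r : k}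
    (h : α x = r • β x) {p : MvPolynomial (Fin m) k} (hp : p ∈ minorIdeal α β) :
    MvPolynomial.eval x p = 0 := by
  have hle : minorIdeal α β ≤ RingHom.ker (MvPolynomial.eval x) := by
    refine Ideal.span_le.2 ?_
    rintro _ ⟨i, j, -, rfl⟩
    simp only [SetLike.mem_coe, RingHom.mem_ker, Matrix.det_fin_two, pairMatrix, map_sub, map_mul,
      Matrix.submatrix_apply, Matrix.of_apply, Matrix.cons_val_zero, Matrix.cons_val_one, id,
      eval_toMvPolynomial, h, Pi.smul_apply, smul_eq_mul]
    ring
  exact hle hp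

theorem notMem_closedSubspace_ker {α : Module.End k (Fin m → k)} {i : Fin m}
    {p : PrimeSpectrum (MvPolynomial (Fin m) k)}
    (h : (LinearMap.toMatrix' α).toMvPolynomial i ∉ p.asIdeal) :
    p ∉ closedSubspace (LinearMap.ker α) := by
  refine fun hp => h (hp ?_)
  rw [SetLike.mem_coe, MvPolynomial.mem_vanishingIdeal_iff]
  intro x hx
  rw [MvPolynomial.aeval_eq_eval, eval_toMvPolynomial, LinearMap.mem_ker.1 hx,
    Pi.zero_apply]

/-- The basic open subset of `Y α β` defined by `f` has dimension at most that of `U α β`, if it is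
contained in `U α β`. -/
theorem ringKrullDim_away_le_topologicalKrullDim_U {α β : Module.End k (Fin m → k)}
    (f : MvPolynomial (Fin m) k)
    (hf : ∀ p ∈ Y α β, f ∉ p.asIdeal → p ∈ U α β) :
    ringKrullDim (Localization.Away (Ideal.Quotient.mk (minorIdeal α β) f)) ≤
      topologicalKrullDim (U α β) := by
  set I := minorIdeal α β
  set B := Localization.Away (Ideal.Quotient.mk I f)
  let φ : PrimeSpectrum B → PrimeSpectrum (MvPolynomial (Fin m) k) :=
    PrimeSpectrum.comap (Ideal.Quotient.mk I) ∘
      PrimeSpectrum.comap (algebraMap (MvPolynomial (Fin m) k ⧸ I) B)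
  have hφ : Topology.IsInducing φ :=
    (PrimeSpectrum.isClosedEmbedding_comap_of_surjective _ _
      Ideal.Quotient.mk_surjective).isInducing.comp
      (PrimeSpectrum.localization_away_isOpenEmbedding B (Ideal.Quotient.mk I f)).isInducing
  have hφU : ∀ p, φ p ∈ U α β := by
    intro p
    refine hf _ (fun g hg => ?_) fun hfp => ?_
    · have : Ideal.Quotient.mk I g = 0 := Ideal.Quotient.eq_zero_iff_mem.2 hg
      simp [φ, this]
    · refine p.2.ne_top (Ideal.eq_top_of_isUnit_mem _ hfp ?_)
      exact IsLocalization.Away.algebraMap_isUnit (Ideal.Quotient.mk I f)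
  rw [← PrimeSpectrum.topologicalKrullDim_eq_ringKrullDim]
  exact (hφ.codRestrict hφU).topologicalKrullDim_le

/-- A generic `n`-dimensional subspace contains no point of the determinantal locus `U α β`, if the
latter has dimension at most `m - n`. -/
theorem holdsGenerically_avoids_U (hnm : n ≤ m) {α β : Module.End k (Fin m → k)}
    (hU : topologicalKrullDim (U α β) ≤ ((m - n : ℕ) : WithBot ℕ∞)) :
    HoldsGenerically fun A : Fin m × Fin n → k => ∀ (c : Fin n → k) (r : k),
      α ((matrixOf A).mulVec c) = r • β ((matrixOf A).mulVec c) →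
      (α - β) ((matrixOf A).mulVec c) ≠ 0 → α ((matrixOf A).mulVec c) ≠ 0 →
      β ((matrixOf A).mulVec c) = 0 := by
  -- The locus `U α β` is covered by the basic open subsets of `Y α β` defined by the products of a
  -- coordinate of `(α - β) x`, one of `α x` and one of `β x`.
  let f : Fin m × Fin m × Fin m → MvPolynomial (Fin m) k := fun t =>
    (LinearMap.toMatrix' (α - β)).toMvPolynomial t.1 *
      (LinearMap.toMatrix' α).toMvPolynomial t.2.1 * (LinearMap.toMatrix' β).toMvPolynomial t.2.2
  have hf : ∀ t, ∀ p ∈ Y α β, f t ∉ p.asIdeal → p ∈ U α β := by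
    refine fun t p hp hft => ⟨hp, ?_⟩
    have h1 : ∀ {a b}, a * b ∉ p.asIdeal → a ∉ p.asIdeal ∧ b ∉ p.asIdeal := fun h =>
      ⟨fun ha => h (Ideal.mul_mem_right _ _ ha), fun hb => h (Ideal.mul_mem_left _ _ hb)⟩
    obtain ⟨h12, h3⟩ := h1 hft
    obtain ⟨h1, h2⟩ := h1 h12
    rintro ((h | h) | h)
    · exact notMem_closedSubspace_ker h1 h
    · exact notMem_closedSubspace_ker h2 h
    · exact notMem_closedSubspace_ker h3 h
  refine (HoldsGenerically.forall_finite fun t => holdsGenerically_mulVec_ne hnm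
    ((ringKrullDim_away_le_topologicalKrullDim_U (f t) (hf t)).trans hU)
    fun i => algebraMap _ _ (Ideal.Quotient.mk (minorIdeal α β) (MvPolynomial.X i))).mono
      fun A hA c r hr h1 h2 => ?_
  by_contra h3
  obtain ⟨j, hj⟩ : ∃ j, c j ≠ 0 := by
    by_contra! hc
    rw [show c = 0 from funext hc] at h2
    simp at h2
  obtain ⟨i₁, h1⟩ := Function.ne_iff.1 h1
  obtain ⟨i₂, h2⟩ := Function.ne_iff.1 h2
  obtain ⟨i₃, h3⟩ := Function.ne_iff.1 h3
  set x := (matrixOf A).mulVec ((c j)⁻¹ • c) with hx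
  have hx' : x = (c j)⁻¹ • (matrixOf A).mulVec c := Matrix.mulVec_smul _ _ _
  have hxr : α x = r • β x := by
    rw [hx', map_smul, map_smul, hr, smul_comm]
  have hfx : MvPolynomial.eval x (f (i₁, i₂, i₃)) ≠ 0 := by
    simp only [f, map_mul, eval_toMvPolynomial]
    rw [hx']
    simp only [map_smul, Pi.smul_apply, smul_eq_mul]
    have := inv_ne_zero hj
    exact mul_ne_zero (mul_ne_zero (mul_ne_zero this h1) (mul_ne_zero this h2))
      (mul_ne_zero this h3)
  let ψ : (MvPolynomial (Fin m) k ⧸ minorIdeal α β) →ₐ[k] k :=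
    Ideal.Quotient.liftₐ _ (MvPolynomial.aeval x) fun p hp => by
      simpa [MvPolynomial.aeval_eq_eval] using eval_eq_zero_of_mem_minorIdeal hxr hp
  have hψ : ∀ p, ψ (Ideal.Quotient.mk _ p) = MvPolynomial.eval x p := fun p => by
    simp [ψ]
  refine hA (i₁, i₂, i₃) j ((c j)⁻¹ • c) (inv_mul_cancel₀ hj)
    (IsLocalization.liftAlgHom (M := Submonoid.powers (Ideal.Quotient.mk _ (f (i₁, i₂, i₃))))
      (f := ψ) ?_) ?_
  · rintro ⟨_, e, rfl⟩
    rw [map_pow, hψ]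
    exact (pow_ne_zero e hfx).isUnit
  · ext i
    simp [hψ, hx]

/-! ### Independent pairs of vectors -/

theorem sum_eq_add_add_sum_subtype_ne {ι M : Type*} [Fintype ι] [DecidableEq ι] [AddCommMonoid M]
    (f : ι → M) {p q : ι} (h : p ≠ q) :
    ∑ l, f l = f p + f q + ∑ l : {l // l ≠ p ∧ l ≠ q}, f l := by
  rw [← Finset.sum_subtype (Finset.univ \ {p, q}) (by simp) f, ← Finset.sum_pair h, add_comm,
    Finset.sum_sdiff (Finset.subset_univ _)]

theorem card_subtype_ne_and_ne {p q : Fin n} (h : p ≠ q) :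
    Fintype.card {l // l ≠ p ∧ l ≠ q} = n - 2 := by
  rw [Fintype.card_of_subtype (Finset.univ \ {p, q}) (by simp),
    Finset.card_sdiff_of_subset (Finset.subset_univ _), Finset.card_pair h, Finset.card_univ,
    Fintype.card_fin]

/-- A generic `n`-dimensional subspace `V` contains no independent pair `(v₁, v₂)` in a subspace `K`
of `k^m × k^m` of dimension at most `2(m - n)`: columns `p` and `q` of a matrix with column space
`V` are determined by the pair, by the other columns and by `2n - 1` coefficients, one of the `2n`
being removed by scaling the pair. -/
theorem holdsGenerically_not_mem_of_independent
    (K : Submodule k ((Fin m → k) × (Fin m → k)))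
    (hK : Module.finrank k K + 2 * n ≤ 2 * m) :
    HoldsGenerically fun A : Fin m × Fin n → k => ∀ c d, c ≠ 0 → (∀ r : k, d ≠ r • c) →
      ((matrixOf A).mulVec c, (matrixOf A).mulVec d) ∉ K := by
  let b := Module.finBasis k K
  let S (p q : Fin n) := Fin (Module.finrank k K) ⊕ ({l // l ≠ p ∧ l ≠ q} × Fin m) ⊕
    {l // l ≠ p ∧ l ≠ q} ⊕ {l // l ≠ p ∧ l ≠ q} ⊕ Fin 3
  have hcard : ∀ t : {t : Fin n × Fin n // t.1 ≠ t.2},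
      0 + Fintype.card (S t.1.1 t.1.2) < Fintype.card (Fin m × Fin n) := by
    rintro ⟨⟨p, q⟩, hpq : p ≠ q⟩
    have hn : 2 ≤ n := by
      have := Fin.val_ne_of_ne hpq
      omega
    simp only [S, Fintype.card_sum, Fintype.card_prod, Fintype.card_fin,
      card_subtype_ne_and_ne hpq]
    obtain ⟨n, rfl⟩ := Nat.exists_eq_add_of_le' hn
    simp only [Nat.add_sub_cancel]
    have : m * (n + 2) = n * m + 2 * m := by ring
    omega
  have hd : ringKrullDim k ≤ ((0 : ℕ) : WithBot ℕ∞) := by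
    rw [ringKrullDim_eq_zero_of_field, Nat.cast_zero]
  let V₁ (p q : Fin n) (i : Fin m) : MvPolynomial (S p q) k :=
    ∑ t, .C ((b t).1.1 i) * .X (.inl t)
  let V₂ (p q : Fin n) (i : Fin m) : MvPolynomial (S p q) k :=
    ∑ t, .C ((b t).1.2 i) * .X (.inl t)
  -- The entries of columns `q` and `p`, expressed through `v₁ = V₁`, `v₂ = V₂`, the other columns
  -- and the coefficients.
  let Cq (p q : Fin n) (i : Fin m) : MvPolynomial (S p q) k :=
    .X (.inr (.inr (.inr (.inr 0)))) * V₂ p q i + .X (.inr (.inr (.inr (.inr 1)))) * V₁ p q i +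
      ∑ l, .X (.inr (.inr (.inl l))) * .X (.inr (.inl (l, i)))
  let Cp (p q : Fin n) (i : Fin m) : MvPolynomial (S p q) k :=
    V₁ p q i - .X (.inr (.inr (.inr (.inr 2)))) * Cq p q i -
      ∑ l, .X (.inr (.inr (.inr (.inl l)))) * .X (.inr (.inl (l, i)))
  refine (HoldsGenerically.forall_finite fun t => HoldsGenerically.not_mem_image hd (hcard t)
    fun ij => if hp : ij.2 = t.1.1 then Cp t.1.1 t.1.2 ij.1 else
      if hq : ij.2 = t.1.2 then Cq t.1.1 t.1.2 ij.1 else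
        .X (.inr (.inl (⟨ij.2, hp, hq⟩, ij.1)))).mono fun A hA c d hc hcd hmem => ?_
  obtain ⟨p, hp⟩ := Function.ne_iff.1 hc
  rw [Pi.zero_apply] at hp
  obtain ⟨q, hq⟩ := Function.ne_iff.1 (hcd (d p / c p))
  have hpq : p ≠ q := by
    rintro rfl
    simp [hp] at hq
  -- Normalize the pair to `c' p = 1`.
  set c' := (c p)⁻¹ • c with hc'
  set d' := (c p)⁻¹ • d with hd'
  have hc'p : c' p = 1 := inv_mul_cancel₀ hp
  have hmem' : ((matrixOf A).mulVec c', (matrixOf A).mulVec d') ∈ K := by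
    rw [hc', hd', Matrix.mulVec_smul, Matrix.mulVec_smul]
    exact K.smul_mem (c p)⁻¹ hmem
  have he : d' q - d' p * c' q ≠ 0 := by
    intro h0
    apply hq
    have h1 : (c p)⁻¹ * (d q - d p / c p * c q) = 0 := by
      rw [← h0, hc', hd']
      simp only [Pi.smul_apply, smul_eq_mul]
      ring
    simpa [hp, sub_eq_zero] using h1
  set e := d' q - d' p * c' q with hedef
  clear_value c' d'
  obtain ⟨z, hs⟩ := exists_sum_smul_eq_of_mem b hmem'
  have hs₁ : ∀ i, ∑ t, (b t).1.1 i * z t = ∑ j, A (i, j) * c' j := fun i => by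
    have := congrFun (congrArg Prod.fst hs) i
    simpa [Prod.fst_sum, Finset.sum_apply, Matrix.mulVec, dotProduct, mul_comm] using this
  have hs₂ : ∀ i, ∑ t, (b t).1.2 i * z t = ∑ j, A (i, j) * d' j := fun i => by
    have := congrFun (congrArg Prod.snd hs) i
    simpa [Prod.snd_sum, Finset.sum_apply, Matrix.mulVec, dotProduct, mul_comm] using this
  let s : S p q → k := Sum.elim z (Sum.elim (fun t => A (t.2, t.1))
    (Sum.elim (fun l => -(d' l - d' p * c' l) / e)
      (Sum.elim (fun l => c' l) ![e⁻¹, -d' p / e, c' q])))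
  obtain ⟨⟨i, j⟩, ht⟩ := hA ⟨(p, q), hpq⟩ (Algebra.ofId k k) s
  have hCq : MvPolynomial.aevalTower (Algebra.ofId k k) s (Cq p q i) = A (i, q) := by
    simp only [s, Cq, V₁, V₂, map_add, map_sum, map_mul, MvPolynomial.aevalTower_X,
      MvPolynomial.aevalTower_C, Sum.elim_inl, Sum.elim_inr, Algebra.ofId_apply,
      Algebra.algebraMap_self, RingHom.id_apply, hs₁, hs₂, Matrix.cons_val]
    rw [sum_eq_add_add_sum_subtype_ne _ hpq, sum_eq_add_add_sum_subtype_ne _ hpq, hc'p]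
    have : ∑ l : {l // l ≠ p ∧ l ≠ q}, -(d' l - d' p * c' l) / e * A (i, l) =
        -(∑ l : {l // l ≠ p ∧ l ≠ q}, A (i, l) * d' l) / e +
          d' p / e * ∑ l : {l // l ≠ p ∧ l ≠ q}, A (i, l) * c' l := by
      rw [Finset.mul_sum, ← Finset.sum_neg_distrib, Finset.sum_div, ← Finset.sum_add_distrib]
      exact Finset.sum_congr rfl fun l _ => by ring
    rw [this]
    field_simp
    rw [hedef]
    ring
  apply ht
  by_cases hjp : j = p
  · subst hjp
    simp only [s, dite_true, Cp, map_sub, map_mul, hCq, MvPolynomial.aevalTower_X, V₁, map_sum,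
      MvPolynomial.aevalTower_C, Sum.elim_inl, Sum.elim_inr, Algebra.ofId_apply,
      Algebra.algebraMap_self, RingHom.id_apply, hs₁, Matrix.cons_val]
    rw [sum_eq_add_add_sum_subtype_ne _ hpq, hc'p]
    simp only [mul_comm]
    ring
  · by_cases hjq : j = q
    · subst hjq
      simpa [hjp] using hCq
    · simp [s, hjp, hjq]

/-! ### Zariski open sets of subspaces -/

theorem pointToPoint_mem_basicOpen {ι : Type*} {x : ι → k} {P : MvPolynomial ι k} :
    (MvPolynomial.pointToPoint x : PrimeSpectrum (MvPolynomial ι k)) ∈ PrimeSpectrum.basicOpen P ↔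
      MvPolynomial.eval x P ≠ 0 := by
  rw [PrimeSpectrum.mem_basicOpen, MvPolynomial.pointToPoint,
    MvPolynomial.mem_vanishingIdeal_singleton_iff, MvPolynomial.aeval_eq_eval]

theorem Frame.isOpen_eval_ne_zero (P : MvPolynomial (Fin m × Fin n) k) :
    IsOpen {A : Frame k n m | MvPolynomial.eval A.1 P ≠ 0} :=
  isOpen_induced_iff.2 ⟨_, PrimeSpectrum.isOpen_basicOpen (a := P),
    Set.ext fun _ => pointToPoint_mem_basicOpen⟩

theorem Frame.exists_eval_ne_zero_subset {W : Set (Frame k n m)} (hW : IsOpen W) {A : Frame k n m}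
    (hA : A ∈ W) : ∃ P : MvPolynomial (Fin m × Fin n) k, MvPolynomial.eval A.1 P ≠ 0 ∧
      ∀ B : Frame k n m, MvPolynomial.eval B.1 P ≠ 0 → B ∈ W := by
  obtain ⟨W', hW', rfl⟩ := isOpen_induced_iff.1 hW
  obtain ⟨_, ⟨P, rfl⟩, hAP, hPW⟩ :=
    PrimeSpectrum.isTopologicalBasis_basic_opens.exists_subset_of_mem_open hA hW'
  exact ⟨P, pointToPoint_mem_basicOpen.1 hAP, fun B hB => hPW (pointToPoint_mem_basicOpen.2 hB)⟩

theorem Frame.mem_toGr_iff {A : Frame k n m} {v : Fin m → k} :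
    v ∈ A.toGr.1 ↔ ∃ c, (matrixOf A.1).mulVec c = v := by
  rw [Frame.toGr, Submodule.mem_span_range_iff_exists_fun]
  refine exists_congr fun c => Eq.congr_left ?_
  ext i
  simp [Matrix.mulVec, dotProduct, Finset.sum_apply, mul_comm]

theorem Frame.toGr_surjective : Function.Surjective (Frame.toGr (k := k) (n := n) (m := m)) := by
  rintro ⟨V, hV⟩
  let b := Module.finBasisOfFinrankEq k V hV
  refine ⟨⟨fun t => (b t.2).1 t.1, b.linearIndependent.map' V.subtype V.ker_subtype⟩, ?_⟩
  apply Subtype.ext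
  have h := congrArg (Submodule.map V.subtype) b.span_eq
  rw [Submodule.map_span, ← Set.range_comp, Submodule.map_subtype_top] at h
  exact h

theorem linearIndependent_of_mulVec_injective {A : Fin m × Fin n → k}
    (h : ∀ c, (matrixOf A).mulVec c = 0 → c = 0) :
    LinearIndependent k fun (j : Fin n) (i : Fin m) => A (i, j) := by
  rw [Fintype.linearIndependent_iff]
  intro c hc j
  refine congrFun (h c ?_) j
  rw [← hc]
  ext i
  simp [Matrix.mulVec, dotProduct, Finset.sum_apply, mul_comm]

/-- A property of subspaces holds on a dense open subset of the Grassmannian when it holds for the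
column spaces of generic matrices. -/
theorem HoldsGenerically.exists_isOpen_dense [Infinite k] {Q : (Fin m × Fin n → k) → Prop}
    (hQ : HoldsGenerically Q)
    (hinj : HoldsGenerically fun A : Fin m × Fin n → k => ∀ c, (matrixOf A).mulVec c = 0 → c = 0) :
    ∃ 𝒰 : Set (Gr k n m), IsOpen 𝒰 ∧ Dense 𝒰 ∧ ∀ V ∈ 𝒰, ∃ A : Frame k n m, A.toGr = V ∧ Q A.1 := by
  obtain ⟨P, hP, hPQ⟩ := hQ.and hinj
  refine ⟨Frame.toGr '' {A | MvPolynomial.eval A.1 P ≠ 0}, ?_, ?_, ?_⟩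
  · rw [isOpen_coinduced, isOpen_iff_forall_mem_open]
    rintro A ⟨A₁, hA₁, hAA₁⟩
    have hcol : ∀ j, ∃ c, (matrixOf A.1).mulVec c = fun i => A₁.1 (i, j) := fun j => by
      rw [← Frame.mem_toGr_iff, ← hAA₁]
      exact Submodule.subset_span ⟨j, rfl⟩
    choose G hG using hcol
    -- `A₁ = A G` for the matrix `G` of coefficients, and `B G` is again a frame of the column space
    -- of `B` for all `B` with `P (B G) ≠ 0`.
    let PG : MvPolynomial (Fin m × Fin n) k :=
      MvPolynomial.bind₁ (fun t => ∑ l, .X (t.1, l) * .C (G t.2 l)) P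
    have hPG : ∀ B, MvPolynomial.eval B PG =
        MvPolynomial.eval (fun t => (matrixOf B).mulVec (G t.2) t.1) P := fun B => by
      simp only [PG, ← MvPolynomial.aeval_eq_eval, MvPolynomial.aeval_bind₁]
      simp [Matrix.mulVec, dotProduct]
    refine ⟨_, fun B hB => ?_, Frame.isOpen_eval_ne_zero PG, ?_⟩
    · rw [Set.mem_ofPred_eq, hPG] at hB
      let B₁ : Frame k n m := ⟨_, linearIndependent_of_mulVec_injective (hPQ _ hB).2⟩
      refine ⟨B₁, hB, Subtype.ext (Submodule.eq_of_le_of_finrank_eq ?_ ?_)⟩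
      · refine Submodule.span_le.2 ?_
        rintro _ ⟨j, rfl⟩
        exact Frame.mem_toGr_iff.2 ⟨G j, rfl⟩
      · rw [B₁.toGr.2, B.toGr.2]
    · rw [Set.mem_ofPred_eq, hPG]
      simp only [hG]
      exact hA₁
  · rw [dense_iff_inter_open]
    rintro W hW ⟨V, hV⟩
    obtain ⟨A, rfl⟩ := Frame.toGr_surjective V
    obtain ⟨P', hP', hPW⟩ := Frame.exists_eval_ne_zero_subset (isOpen_coinduced.1 hW) hV
    have hne : P * P' ≠ 0 := mul_ne_zero hP fun h => hP' (by rw [h, map_zero])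
    obtain ⟨B, hB⟩ : ∃ B, MvPolynomial.eval B (P * P') ≠ 0 := by
      by_contra! h
      exact hne (MvPolynomial.funext fun B => by rw [h, map_zero])
    rw [map_mul] at hB
    have hB₁ := left_ne_zero_of_mul hB
    let B₁ : Frame k n m := ⟨B, linearIndependent_of_mulVec_injective (hPQ B hB₁).2⟩
    exact ⟨B₁.toGr, hPW B₁ (right_ne_zero_of_mul hB), B₁, hB₁, rfl⟩
  · rintro _ ⟨A, hA, rfl⟩
    exact ⟨A, rfl, (hPQ _ hA).1⟩

end HomSensing

theorem theorem1 {k : Type*} [Field k] [Infinite k] (n m : ℕ) (hn : 2 * n ≤ m)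
    (τ₁ τ₂ ρ : Module.End k (Fin m → k))
    (hρ : IsIdempotentElem ρ) (hρτ : LinearMap.range ρ = LinearMap.range τ₂)
    (hU : topologicalKrullDim (HomSensing.U (ρ ∘ₗ τ₁) τ₂) ≤ ((m - n : ℕ) : WithBot ℕ∞))
    (h₂ : 2 * n ≤ Module.finrank k (LinearMap.range τ₂))
    (h₁ : n ≤ Module.finrank k (LinearMap.range τ₁)) :
    ∃ 𝒰 : Set (HomSensing.Gr k n m), IsOpen 𝒰 ∧ Dense 𝒰 ∧
      ∀ V ∈ 𝒰, ∀ v₁ ∈ V.1, ∀ v₂ ∈ V.1, τ₁ v₁ = τ₂ v₂ → v₁ = v₂ := by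
  open HomSensing in
  have hnm : n ≤ m := by omega
  have hρ₂ : ∀ w, ρ (τ₂ w) = τ₂ w := fun w => by
    obtain ⟨u, hu⟩ : τ₂ w ∈ LinearMap.range ρ := hρτ ▸ LinearMap.mem_range_self τ₂ w
    rw [← hu]
    exact LinearMap.congr_fun hρ u
  -- The pairs `(v₁, v₂)` with `ρ (τ₁ v₁) = τ₂ v₂` form a subspace of codimension at least
  -- `rank τ₂`.
  let δ : (Fin m → k) × (Fin m → k) →ₗ[k] (Fin m → k) := (ρ ∘ₗ τ₁).coprod (-τ₂)
  have hδ : LinearMap.range τ₂ ≤ LinearMap.range δ := by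
    rintro _ ⟨w, rfl⟩
    exact ⟨(0, -w), by simp [δ]⟩
  have hK : Module.finrank k (LinearMap.ker δ) + 2 * n ≤ 2 * m := by
    have h := δ.finrank_range_add_finrank_ker
    rw [Module.finrank_prod, Module.finrank_fin_fun] at h
    have := Submodule.finrank_mono hδ
    omega
  have hker₁ := holdsGenerically_ker_eq_bot hnm τ₁ h₁
  obtain ⟨𝒰, hopen, hdense, h𝒰⟩ := HoldsGenerically.exists_isOpen_dense
    ((hker₁.and (holdsGenerically_ker_eq_bot hnm τ₂ (by omega))).and
      ((holdsGenerically_avoids_U hnm hU).and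
        (holdsGenerically_not_mem_of_independent (LinearMap.ker δ) hK)))
    (hker₁.mono fun A hA c hc => hA c (by rw [hc, map_zero]))
  refine ⟨𝒰, hopen, hdense, fun V hV v₁ hv₁ v₂ hv₂ hv => ?_⟩
  obtain ⟨A, rfl, ⟨hinj₁, hinj₂⟩, hAU, hAK⟩ := h𝒰 V hV
  obtain ⟨c, rfl⟩ := Frame.mem_toGr_iff.1 hv₁
  obtain ⟨d, rfl⟩ := Frame.mem_toGr_iff.1 hv₂
  have hρv : ρ (τ₁ ((matrixOf A.1).mulVec c)) = τ₂ ((matrixOf A.1).mulVec d) := by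
    rw [hv, hρ₂]
  by_cases hc : c = 0
  · subst hc
    rw [Matrix.mulVec_zero, map_zero] at hv
    rw [hinj₂ d hv.symm]
  by_cases hcd : ∃ r : k, d = r • c
  · obtain ⟨r, rfl⟩ := hcd
    by_contra hne
    rw [Matrix.mulVec_smul, map_smul] at hρv
    have h2 : τ₂ ((matrixOf A.1).mulVec c) ≠ 0 := fun h => hc (hinj₂ c h)
    refine h2 (hAU c r hρv ?_ ?_)
    · rw [LinearMap.sub_apply, LinearMap.comp_apply, hρv]
      intro h
      have h' : (r - 1) • τ₂ ((matrixOf A.1).mulVec c) = 0 := by rw [sub_smul, one_smul, h]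
      have hr : r = 1 := sub_eq_zero.1 ((smul_eq_zero.1 h').resolve_right h2)
      exact hne (by rw [hr, one_smul])
    · rw [LinearMap.comp_apply, hρv]
      intro h
      refine hc (hinj₁ c ?_)
      rw [hv, Matrix.mulVec_smul, map_smul, h]
  · push Not at hcd
    refine absurd ?_ (hAK c d hc hcd)
    rw [LinearMap.mem_ker]
    simp [δ, hρv]
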